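/- Let $n\ge 1$, $\epsilon_0\ge 0$ and $\lambda>1$. For probability measures $U,V$ on the same measurable space let $$D^\lambda(U\|V)=\frac1{\lambda-1}\log \mathbb E_{x\sim V}\Big[\Big(\frac{dU}{dV}(x)\Big)^\lambda\Big]\in[0,\infty]$$ be the Rényi divergence of order $\lambda$, with $D^\lambda(U\|V)=\infty$ if $U$ is not absolutely continuous with respect to $V$. Let $\mathcal D$ be a set, let $\mathcal S^{(1)},\dots,\mathcal S^{(n)}$ be measurable spaces, and for $i\in[n]$ let $\mathcal R^{(i)}:\mathcal S^{(1)}\times\cdots\times\mathcal S^{(i-1)}\times\mathcal D\to\mathcal S^{(i)}$ be a randomized algorithm (for each fixed $x\in\mathcal D$, a Markov kernel $z_{1:i-1}\mapsto\mathcal R^{(i)}(z_{1:i-1},x)$). Suppose that for every $i$ and every $z_{1:i-1}$ the randomizer $\mathcal R^{(i)}(z_{1:i-1},\cdot)$ is $\epsilon_0$-LDP, that is, $$\mathbb P(\mathcal R^{(i)}(z_{1:i-1},x)\in E)\le e^{\epsilon_0}\,\mathbb P(\mathcal R^{(i)}(z_{1:i-1},x')\in E)$$ for all $x,x'\in\mathcal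 D$ and all measurable $E\subseteq \mathcal S^{(i)}$. Let $\mathcal A_{R,S}$ be the shuffled adaptive process: on input $X=(x_1,\dots,x_n)\in\mathcal D^n$ it draws a uniformly random permutation $\pi$ of $[n]$, computes successively $z_i=\mathcal R^{(i)}(z_{1:i-1},x_{\pi(i)})$ for $i=1,\dots,n$, and outputs $z_{1:n}$. Put $p=e^{-\epsilon_0}$, let $C\sim \mathrm{Bin}(n-1,p)$, let $A\sim\mathrm{Bin}(C,1/2)$ given $C$, and let $\Delta\sim\mathrm{Bern}\big(\frac1{1+p}\big)$ be independent of $(A,C)$. Let $P$ be the law of $(A+\Delta,\;C-A+1-\Delta)$ and $Q$ the law of $(A+1-\Delta,\;C-A+\Delta)$. Then $\mathcal A_{R,S}$ satisfies $\big(\lambda,\max\{D^\lambda(P\|Q),D^\lambda(Q\|P)\}\big)$-RDP: for all $X_0,X_1\in\mathcal D^n$ that differ in exactly one record, $$D^\lambda(\mathcal A_{R,S}(X_0)\|\mathcal A_{R,S}(X_1))\le\max\{D^\lambda(P\|Q),D^\lambda(Q\|P)\}.$$ -/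

import Mathlib

open MeasureTheory ProbabilityTheory
open scoped ENNReal NNReal unitInterval

noncomputable section

namespace ShuffleRDP

/-- Rényi divergence of order `lam` of two probability measures,
`(lam - 1)⁻¹ * log E_{x ∼ ν} [(dμ/dν)(x) ^ lam]`, as an extended real number. As usual it is `⊤`
when `μ` is not absolutely continuous with respect to `ν`. -/
def renyiDiv {Ω : Type*} [MeasurableSpace Ω] (lam : ℝ) (μ ν : Measure Ω) : EReal :=
  open Classical in
  if μ ≪ ν then
    (((lam - 1)⁻¹ : ℝ) : EReal) * ENNReal.log (∫⁻ x, (μ.rnDeriv ν x) ^ lam ∂ν)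
  else ⊤

/-- Two data sets are neighbouring if they differ in exactly one record. -/
def Neighbouring {n : ℕ} {D : Type*} (X₀ X₁ : Fin n → D) : Prop :=
  ∃! i, X₀ i ≠ X₁ i

/-- A local randomizer, given by the law `M x` of its output on each input `x`, is `ε`-LDP. -/
def IsLDP {D Ω : Type*} [MeasurableSpace Ω] (ε : ℝ) (M : D → Measure Ω) : Prop :=
  ∀ x x' : D, ∀ E : Set Ω, MeasurableSet E → M x E ≤ ENNReal.ofReal (Real.exp ε) * M x' E

/-- A mechanism on data sets of size `n`, given by the law `M X` of its output on each data
set `X`, is `(lam, ε)`-RDP. -/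
def IsRDP {n : ℕ} {D Ω : Type*} [MeasurableSpace Ω] (lam : ℝ) (ε : EReal)
    (M : (Fin n → D) → Measure Ω) : Prop :=
  ∀ X₀ X₁ : Fin n → D, Neighbouring X₀ X₁ → renyiDiv lam (M X₀) (M X₁) ≤ ε

/-- The tuples `(z₁, …, z_k)` of the first `k` outputs. -/
abbrev Prefix {n : ℕ} (S : Fin n → Type*) (k : ℕ) (hk : k ≤ n) : Type _ :=
  (j : Fin k) → S (j.castLE hk)

/-- The law of the first `k` outputs when they are drawn one after the other, the output with
(zero-based) index `i` being drawn from `K i` given all the earlier outputs. -/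
def prefixLaw {n : ℕ} {S : Fin n → Type*} [∀ i, MeasurableSpace (S i)]
    (K : (i : Fin n) → Kernel (Prefix S i i.isLt.le) (S i)) :
    (k : ℕ) → (hk : k ≤ n) → Measure (Prefix S k hk)
  | 0, _ => Measure.dirac (fun j => j.elim0)
  | k + 1, hk =>
      ((prefixLaw K k (Nat.le_of_succ_le hk)) ⊗ₘ (K ⟨k, hk⟩)).map
        (fun w => Fin.snoc (α := fun j : Fin (k + 1) => S (j.castLE hk)) w.1 w.2)

/-- The law of all `n` outputs `(z₁, …, z_n)` drawn one after the other from `K`. -/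
def sequentialLaw {n : ℕ} {S : Fin n → Type*} [∀ i, MeasurableSpace (S i)]
    (K : (i : Fin n) → Kernel (Prefix S i i.isLt.le) (S i)) : Measure ((i : Fin n) → S i) :=
  prefixLaw K n le_rfl

/-- The adaptive process: the output law of `zᵢ = R i (z₁, …, zᵢ₋₁, xᵢ)`, `i = 1, …, n`. Here
`R i x` is the kernel sending the earlier outputs to the law of the `i`-th output on input `x`. -/
def adaptiveProcess {n : ℕ} {D : Type*} {S : Fin n → Type*} [∀ i, MeasurableSpace (S i)]
    (R : (i : Fin n) → D → Kernel (Prefix S i i.isLt.le) (S i)) (X : Fin n → D) :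
    Measure ((i : Fin n) → S i) :=
  sequentialLaw (fun i => R i (X i))

/-- The shuffled adaptive process: a permutation `π` is drawn uniformly, and the adaptive process
is run on the permuted data set, `zᵢ = R i (z₁, …, zᵢ₋₁, x_{π(i)})`. -/
def shuffledProcess {n : ℕ} {D : Type*} {S : Fin n → Type*} [∀ i, MeasurableSpace (S i)]
    (R : (i : Fin n) → D → Kernel (Prefix S i i.isLt.le) (S i)) (X : Fin n → D) :
    Measure ((i : Fin n) → S i) :=
  ∑ π : Equiv.Perm (Fin n), (n.factorial : ℝ≥0∞)⁻¹ • adaptiveProcess R (fun i => X (π i))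

/-- `p = e^{-ε₀}`. -/
def cloneProb (ε₀ : ℝ≥0) : I :=
  ⟨Real.exp (-ε₀), (Real.exp_pos _).le, Real.exp_le_one_iff.2 (neg_nonpos.2 ε₀.2)⟩

/-- `1 / (1 + p) = e^{ε₀} / (e^{ε₀} + 1)`, where `p = e^{-ε₀}`. -/
def flipProb (ε₀ : ℝ≥0) : I :=
  ⟨1 / (1 + Real.exp (-ε₀)), by positivity,
    (div_le_one (by positivity)).2 (le_add_of_nonneg_right (Real.exp_pos _).le)⟩

/-- The fair-coin parameter `1 / 2`. -/
def halfProb : I := ⟨1 / 2, by norm_num, by norm_num⟩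

/-- The joint law of `(C, A)`, where `C ∼ Bin(n - 1, p)` and, given `C`, `A ∼ Bin(C, 1/2)`. -/
def countLaw (n : ℕ) (ε₀ : ℝ≥0) : Measure (ℕ × ℕ) :=
  (binomial (n - 1) (cloneProb ε₀)).bind
    (fun c => (binomial c halfProb).map (fun a => (c, a)))

/-- The joint law of `((C, A), Δ)`, where `Δ ∼ Bern(1 / (1 + p))` is independent of `(C, A)`. -/
def countFlipLaw (n : ℕ) (ε₀ : ℝ≥0) : Measure ((ℕ × ℕ) × ℕ) :=
  (countLaw n ε₀).prod (bernoulliMeasure 1 0 (flipProb ε₀))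

/-- The law `P` of `(A + Δ, C - A + 1 - Δ)`. The subtractions never truncate, since `A ≤ C` and
`Δ ≤ 1` almost surely. -/
def lawP (n : ℕ) (ε₀ : ℝ≥0) : Measure (ℕ × ℕ) :=
  (countFlipLaw n ε₀).map
    (fun ω => (ω.1.2 + ω.2, ω.1.1 - ω.1.2 + 1 - ω.2))

/-- The law `Q` of `(A + 1 - Δ, C - A + Δ)`. -/
def lawQ (n : ℕ) (ε₀ : ℝ≥0) : Measure (ℕ × ℕ) :=
  (countFlipLaw n ε₀).map
    (fun ω => (ω.1.2 + 1 - ω.2, ω.1.1 - ω.1.2 + ω.2))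

end ShuffleRDP

end

/-! Let p = e^{-ε₀}, and let κ₀, κ₁ be the randomizers of a given step on the two values of the
differing record. The bounds p κ₁ ≤ κ₀ and p κ₀ ≤ κ₁ make the pair a randomized response between two
extremal kernels: κ₀ = (η₀ + p η₁)/(1 + p) and κ₁ = (p η₀ + η₁)/(1 + p) (`exists_extremal_kernels`).
Since η₀ + η₁ = κ₀ + κ₁, the LDP condition also shows that the randomizer on any other record
dominates (p/2)(η₀ + η₁): with probability p that record acts as a clone, a fair choice between η₀
and η₁, and otherwise it uses a residual kernel of its own (`exists_clone_residual`).

The mixing weights depend neither on the step nor on the earlier outputs, so the types of all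
records can be drawn in advance. The process becomes a mixture over words in `some true` (η₀), `some
false` (η₁) and `none` (residual) (`shuffledProcess_eq_sum_wordLaw`). Shuffling hides which record
has which clone type; averaging over the choice of the residual records then leaves a law that
depends only on the numbers of the two types (`averagedWordLaw_congr`). Both data sets thus yield
mixtures of the same laws, and the mixing distributions are P and Q (`lintegral_lawP`,
`lintegral_lawQ`). Data processing concludes (`renyiDiv_mixture_le`). -/

namespace ShuffleRDP

/-! ### Data processing for finite mixtures -/

/-- Jensen's inequality for the density of one finite mixture with respect to another one with the
same components. -/
theorem lintegral_rnDeriv_rpow_mixture_le {ι Ω : Type*} [MeasurableSpace Ω] {lam : ℝ}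
    (hlam : 1 ≤ lam) (s : Finset ι) (r b : ι → ℝ≥0∞) (hb : ∀ i ∈ s, b i ≠ ∞)
    (κ : ι → Measure Ω) (hκ : ∀ i ∈ s, κ i Set.univ ≤ 1) :
    ∫⁻ x, ((∑ i ∈ s, (r i * b i) • κ i).rnDeriv (∑ i ∈ s, b i • κ i) x) ^ lam
      ∂(∑ i ∈ s, b i • κ i) ≤ ∑ i ∈ s, r i ^ lam * b i := by
  set ν := ∑ i ∈ s, b i • κ i with hν
  have hfin : IsFiniteMeasure ν := by
    refine ⟨?_⟩
    rw [hν, Measure.finsetSum_apply]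
    refine ENNReal.sum_lt_top.2 fun i hi => ?_
    rw [Measure.smul_apply, smul_eq_mul]
    exact ENNReal.mul_lt_top (hb i hi).lt_top ((hκ i hi).trans_lt ENNReal.one_lt_top)
  -- `h i x` is the posterior weight of component `i` given the outcome `x`. These weights sum to
  -- one almost everywhere, and the density of the other mixture is the posterior mean of `r`, so
  -- Jensen applies pointwise.
  set h : ι → Ω → ℝ≥0∞ := fun i => (b i • κ i).rnDeriv ν with hh
  have hhm : ∀ i, Measurable (h i) := fun i => Measure.measurable_rnDeriv _ _
  have hle : ∀ i ∈ s, b i • κ i ≤ ν := fun i hi =>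
    Finset.single_le_sum (f := fun i => b i • κ i) (fun _ _ => Measure.zero_le _) hi
  have hdens : ∀ i ∈ s, ν.withDensity (h i) = b i • κ i := fun i hi => by
    have : IsFiniteMeasure (b i • κ i) := isFiniteMeasure_of_le ν (hle i hi)
    exact Measure.withDensity_rnDeriv_eq _ _ (Measure.absolutelyContinuous_of_le (hle i hi))
  have hlin : ∀ c : ι → ℝ≥0∞,
      ν.withDensity (fun x => ∑ i ∈ s, h i x * c i) = ∑ i ∈ s, c i • b i • κ i := by
    intro c
    ext E hE
    rw [withDensity_apply _ hE, lintegral_finsetSum _ (fun i _ => (hhm i).mul_const _),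
      Measure.finsetSum_apply]
    refine Finset.sum_congr rfl fun i hi => ?_
    rw [lintegral_mul_const _ (hhm i), ← withDensity_apply _ hE, hdens i hi, mul_comm]
    rfl
  have hone : ∀ᵐ x ∂ν, ∑ i ∈ s, h i x = 1 := by
    have h1 := hlin 1
    have h2 : ν.withDensity (fun x => ∑ i ∈ s, h i x) = ν.withDensity (fun _ => 1) := by
      simpa [hν] using h1
    have h3 := Measure.rnDeriv_withDensity ν (Finset.measurable_fun_sum s fun i _ => hhm i)
    rw [h2] at h3
    have h4 := Measure.rnDeriv_withDensity ν (measurable_const (a := (1 : ℝ≥0∞)))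
    filter_upwards [h3, h4] with x h3 h4
    rw [← h3, h4]
  have hμ : ∑ i ∈ s, (r i * b i) • κ i = ν.withDensity (fun x => ∑ i ∈ s, h i x * r i) := by
    rw [hlin]; simp_rw [mul_smul]
  rw [hμ]
  have hd := Measure.rnDeriv_withDensity ν
    (Finset.measurable_fun_sum s fun i _ => (hhm i).mul_const (r i))
  calc _ ≤ ∫⁻ x, ∑ i ∈ s, h i x * r i ^ lam ∂ν := by
        refine lintegral_mono_ae ?_
        filter_upwards [hd, hone] with x hx h1
        rw [hx]
        exact ENNReal.rpow_arith_mean_le_arith_mean_rpow s (fun i => h i x) r h1 hlam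
    _ = ∑ i ∈ s, r i ^ lam * ∫⁻ x, h i x ∂ν := by
        rw [lintegral_finsetSum _ (fun i _ => (hhm i).mul_const _)]
        refine Finset.sum_congr rfl fun i _ => ?_
        rw [lintegral_mul_const _ (hhm i), mul_comm]
    _ ≤ _ := by
        refine Finset.sum_le_sum fun i hi => ?_
        gcongr
        have : IsFiniteMeasure (b i • κ i) := isFiniteMeasure_of_le ν (hle i hi)
        rw [hh, Measure.lintegral_rnDeriv (Measure.absolutelyContinuous_of_le (hle i hi)),
          Measure.smul_apply, smul_eq_mul]
        exact mul_le_of_le_one_right' (hκ i hi)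

/-- Data processing inequality for the Rényi divergence: two mixtures of the same components are
no further apart than their mixing distributions. -/
theorem renyiDiv_mixture_le {ι Ω : Type*} [MeasurableSpace Ω] [MeasurableSpace ι]
    [MeasurableSingletonClass ι] {lam : ℝ} (hlam : 1 < lam) (P Q : Measure ι)
    [IsFiniteMeasure P] [IsFiniteMeasure Q] (s : Finset ι) (κ : ι → Measure Ω)
    (hκ : ∀ i ∈ s, κ i Set.univ ≤ 1) :
    renyiDiv lam (∑ i ∈ s, P {i} • κ i) (∑ i ∈ s, Q {i} • κ i) ≤ renyiDiv lam P Q := by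
  by_cases hPQ : P ≪ Q
  swap
  · simp [renyiDiv, hPQ]
  have hr : ∀ i, P {i} = P.rnDeriv Q i * Q {i} := fun i => by
    conv_lhs => rw [← Measure.withDensity_rnDeriv_eq P Q hPQ]
    rw [withDensity_apply _ (measurableSet_singleton i), lintegral_singleton]
  have hac : (∑ i ∈ s, P {i} • κ i) ≪ ∑ i ∈ s, Q {i} • κ i := by
    refine Measure.AbsolutelyContinuous.mk fun E hE h0 => ?_
    rw [Measure.finsetSum_apply, Finset.sum_eq_zero_iff] at h0 ⊢
    intro i hi
    have := h0 i hi
    rw [Measure.smul_apply, smul_eq_mul] at this ⊢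
    rw [hr, mul_assoc, this, mul_zero]
  rw [renyiDiv, renyiDiv, if_pos hPQ, if_pos hac]
  have hpos : (0 : EReal) ≤ (((lam - 1)⁻¹ : ℝ) : EReal) := by
    exact_mod_cast inv_nonneg.2 (sub_nonneg.2 hlam.le)
  refine mul_le_mul_of_nonneg_left (ENNReal.log_monotone ?_) hpos
  have h1 := lintegral_rnDeriv_rpow_mixture_le hlam.le s (fun i => P.rnDeriv Q i)
    (fun i => Q {i}) (fun i _ => measure_ne_top _ _) κ hκ
  simp_rw [← hr] at h1
  refine h1.trans ?_
  -- The sum is the integral over `s` alone; enlarging the domain can only increase it.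
  rw [← lintegral_finset]
  exact setLIntegral_le_lintegral _ _

/-! ### Mixtures of sequential laws -/

section Sequential

variable {n : ℕ} {S : Fin n → Type*} [∀ i, MeasurableSpace (S i)]

theorem measurable_prefix_snoc {k : ℕ} (hk : k + 1 ≤ n) :
    Measurable (fun w : Prefix S k (Nat.le_of_succ_le hk) × S ⟨k, hk⟩ =>
      (Fin.snoc (α := fun j : Fin (k + 1) => S (j.castLE hk)) w.1 w.2 : Prefix S (k + 1) hk)) := by
  refine measurable_pi_lambda _ fun j => ?_
  refine Fin.lastCases ?_ (fun j => ?_) j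
  · simp only [Fin.snoc_last]
    exact measurable_snd
  · simp only [Fin.snoc_castSucc]
    exact (measurable_pi_apply j).comp measurable_fst

theorem isProbabilityMeasure_prefixLaw
    (K : (i : Fin n) → Kernel (Prefix S i i.isLt.le) (S i)) [∀ i, IsMarkovKernel (K i)] :
    ∀ (k : ℕ) (hk : k ≤ n), IsProbabilityMeasure (prefixLaw K k hk)
  | 0, _ => by unfold prefixLaw; infer_instance
  | k + 1, hk => by
      have := isProbabilityMeasure_prefixLaw K k (Nat.le_of_succ_le hk)
      unfold prefixLaw
      exact Measure.isProbabilityMeasure_map (measurable_prefix_snoc hk).aemeasurable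

/-- The law of the first `k` outputs only depends on the first `k` kernels. -/
theorem prefixLaw_congr (K K' : (i : Fin n) → Kernel (Prefix S i i.isLt.le) (S i)) :
    ∀ (k : ℕ) (hk : k ≤ n), (∀ i : Fin n, (i : ℕ) < k → K i = K' i) →
      prefixLaw K k hk = prefixLaw K' k hk
  | 0, _, _ => by simp only [prefixLaw]
  | k + 1, hk, h => by
      simp only [prefixLaw]
      rw [prefixLaw_congr K K' k _ fun i hi => h i (Nat.lt_succ_of_lt hi), h ⟨k, hk⟩ k.lt_succ_self]

/-- The word `τ` of length `k`, filled up with the default letter. -/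
def extendWord {T : Type*} [Inhabited T] {k : ℕ} (τ : Fin k → T) (i : Fin n) : T :=
  if h : (i : ℕ) < k then τ ⟨i, h⟩ else default

theorem compProd_mixture {α β ι T : Type*} [MeasurableSpace α] [MeasurableSpace β]
    [Fintype ι] [Fintype T] (v : ι → ℝ≥0∞) (μ : ι → Measure α) [∀ i, SFinite (μ i)]
    [SFinite (∑ i, v i • μ i)]
    (w : T → ℝ≥0∞) (κ : T → Kernel α β) [∀ t, IsSFiniteKernel (κ t)]
    (K : Kernel α β) [IsSFiniteKernel K] (hK : ∀ a, K a = ∑ t, w t • κ t a) :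
    (∑ i, v i • μ i) ⊗ₘ K = ∑ t, ∑ i, (v i * w t) • (μ i ⊗ₘ κ t) := by
  ext E hE
  rw [Measure.compProd_apply hE, lintegral_finsetSum_measure]
  simp only [hK, Measure.finsetSum_apply, Measure.smul_apply, smul_eq_mul,
    Measure.compProd_apply hE, lintegral_smul_measure]
  rw [Finset.sum_comm]
  refine Finset.sum_congr rfl fun i _ => ?_
  have hm : ∀ t, Measurable fun a => κ t a (Prod.mk a ⁻¹' E) :=
    fun t => Kernel.measurable_kernel_prodMk_left hE
  rw [lintegral_finsetSum _ fun t _ => (hm t).const_mul _, Finset.mul_sum]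
  refine Finset.sum_congr rfl fun t _ => ?_
  rw [lintegral_const_mul _ (hm t), mul_assoc]

/-- Induction on `k`: composition-product is linear in both arguments, so each step appends one
letter to the word. The family of kernels needs a letter at every index, hence `extendWord`; by
`prefixLaw_congr` the default letters from position `k` on do not matter. -/
theorem prefixLaw_mixture {T : Type*} [Fintype T] [Inhabited T]
    (w : Fin n → T → ℝ≥0∞) (G : (i : Fin n) → T → Kernel (Prefix S i i.isLt.le) (S i))
    [∀ i t, IsMarkovKernel (G i t)]
    (K : (i : Fin n) → Kernel (Prefix S i i.isLt.le) (S i)) [∀ i, IsMarkovKernel (K i)]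
    (hK : ∀ i z, K i z = ∑ t, w i t • G i t z) :
    ∀ (k : ℕ) (hk : k ≤ n), prefixLaw K k hk =
      ∑ τ : Fin k → T, (∏ j, w (j.castLE hk) (τ j)) •
        prefixLaw (fun i => G i (extendWord τ i)) k hk
  | 0, _ => by simp [prefixLaw]
  | k + 1, hk => by
      have ih := prefixLaw_mixture w G K hK k (Nat.le_of_succ_le hk)
      have hP := isProbabilityMeasure_prefixLaw K k (Nat.le_of_succ_le hk)
      have hP' : ∀ τ : Fin k → T, IsProbabilityMeasure
          (prefixLaw (fun i => G i (extendWord τ i)) k (Nat.le_of_succ_le hk)) :=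
        fun τ => isProbabilityMeasure_prefixLaw _ _ _
      rw [ih] at hP
      rw [prefixLaw, ih, compProd_mixture _ _ (w ⟨k, hk⟩) (G ⟨k, hk⟩) (K ⟨k, hk⟩) (hK ⟨k, hk⟩),
        ← (Fin.snocEquiv fun _ : Fin (k + 1) => T).sum_comp, Fintype.sum_prod_type,
        Measure.map_finset_sum (measurable_prefix_snoc hk).aemeasurable]
      refine Finset.sum_congr rfl fun t _ => ?_
      rw [Measure.map_finset_sum (measurable_prefix_snoc hk).aemeasurable]
      refine Finset.sum_congr rfl fun τ _ => ?_
      rw [Measure.map_smul, Fin.prod_univ_castSucc, prefixLaw]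
      have h1 : extendWord (n := n) (Fin.snocEquiv (fun _ : Fin (k + 1) => T) (t, τ)) ⟨k, hk⟩
          = t := by
        simp [extendWord, Fin.snocEquiv, Fin.snoc]
      have h2 : ∀ i : Fin n, (i : ℕ) < k →
          extendWord (Fin.snocEquiv (fun _ : Fin (k + 1) => T) (t, τ)) i = extendWord τ i := by
        intro i hi
        simp [extendWord, Fin.snocEquiv, Fin.snoc, hi, Nat.lt_succ_of_lt hi]
      rw [prefixLaw_congr (fun i => G i (extendWord (Fin.snocEquiv _ (t, τ)) i))
        (fun i => G i (extendWord τ i)) k _ (fun i hi => by rw [h2 i hi]), h1]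
      congr 1
      simp [Fin.snocEquiv]
      rfl

/-- If every kernel is a mixture, then the sequential law is the corresponding mixture over all
words. -/
theorem sequentialLaw_mixture {T : Type*} [Fintype T] [Inhabited T]
    (w : Fin n → T → ℝ≥0∞) (G : (i : Fin n) → T → Kernel (Prefix S i i.isLt.le) (S i))
    [∀ i t, IsMarkovKernel (G i t)]
    (K : (i : Fin n) → Kernel (Prefix S i i.isLt.le) (S i)) [∀ i, IsMarkovKernel (K i)]
    (hK : ∀ i z, K i z = ∑ t, w i t • G i t z) :
    sequentialLaw K =
      ∑ τ : Fin n → T, (∏ j, w j (τ j)) • sequentialLaw (fun i => G i (τ i)) := by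
  have h := prefixLaw_mixture w G K hK n le_rfl
  have he : ∀ τ : Fin n → T, extendWord (n := n) τ = τ := fun τ => by
    ext i; simp [extendWord]
  simpa [he, sequentialLaw] using h

end Sequential

/-! ### Decomposition of close kernels -/

section Decomposition

variable {α β : Type*} [MeasurableSpace α] [MeasurableSpace β]

/-- A Markov kernel that dominates `c` times another one is a mixture of that one and a
remainder. -/
theorem exists_residual_kernel (κ η : Kernel α β) [IsMarkovKernel κ] [IsMarkovKernel η] {c : ℝ}
    (hc0 : 0 ≤ c) (hc1 : c ≤ 1)
    (h : ∀ a E, MeasurableSet E → c * (η a).real E ≤ (κ a).real E) :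
    ∃ ρ : Kernel α β, IsMarkovKernel ρ ∧ ∀ a E, MeasurableSet E →
      (κ a).real E = c * (η a).real E + (1 - c) * (ρ a).real E := by
  -- For `c = 1` the remainder cannot be normalized. Its weight is zero, and the bound on `E` and
  -- its complement forces equality, so any kernel serves.
  obtain rfl | hc := hc1.eq_or_lt
  · refine ⟨κ, inferInstance, fun a E hE => ?_⟩
    have h1 := h a E hE
    have h2 := h a Eᶜ hE.compl
    rw [probReal_compl_eq_one_sub hE, probReal_compl_eq_one_sub hE] at h2
    linarith
  have hle : ∀ a, c.toNNReal • η a ≤ κ a := fun a => by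
    refine Measure.le_iff.2 fun E hE => ?_
    rw [Measure.smul_apply, ENNReal.smul_def, smul_eq_mul,
      ← ENNReal.toReal_le_toReal (by finiteness) (by finiteness)]
    simpa [measureReal_def, hc0] using h a E hE
  have hpos : 0 < 1 - c := by linarith
  let d : ℝ≥0 := (1 - c)⁻¹.toNNReal
  have hval : ∀ a E, MeasurableSet E → (d • (κ a - c.toNNReal • η a)) E =
      d • (κ a E - c.toNNReal • η a E) := fun a E hE => by
    rw [Measure.smul_apply, Measure.sub_apply hE (hle a), Measure.smul_apply]
  have hmeas : Measurable fun a => d • (κ a - c.toNNReal • η a) := by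
    refine Measure.measurable_of_measurable_coe _ fun E hE => ?_
    simp_rw [hval _ E hE]
    have h1 := κ.measurable_coe hE
    have h2 := η.measurable_coe hE
    exact (h1.sub (h2.const_smul _)).const_smul _
  let ρ : Kernel α β := ⟨_, hmeas⟩
  have hreal : ∀ a E, MeasurableSet E →
      (ρ a E).toReal = (1 - c)⁻¹ * ((κ a).real E - c * (η a).real E) := fun a E hE => by
    have : ρ a E = d • (κ a E - c.toNNReal • η a E) := hval a E hE
    rw [this, ENNReal.smul_def, smul_eq_mul, ENNReal.toReal_mul, ENNReal.toReal_sub_of_le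
      (by simpa using hle a E) (measure_ne_top _ _)]
    simp [d, ENNReal.smul_def, measureReal_def, hc0, hpos.le]
  refine ⟨ρ, ⟨fun a => ⟨?_⟩⟩, fun a E hE => ?_⟩
  · rw [← ENNReal.toReal_eq_one_iff, hreal a _ MeasurableSet.univ]
    simp [hpos.ne']
  · rw [measureReal_def (μ := ρ a), hreal a E hE]
    field_simp
    ring

/-- The extremal kernels are the normalized remainders ηᵢ = (κᵢ - p κ₁₋ᵢ)/(1 - p). Solving these two
linear relations for κ₀ and κ₁ gives the identities multiplied by 1 - p. -/
theorem exists_extremal_kernels (κ₀ κ₁ : Kernel α β) [IsMarkovKernel κ₀] [IsMarkovKernel κ₁]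
    {p : ℝ} (hp0 : 0 ≤ p) (hp1 : p ≤ 1)
    (h₀ : ∀ a E, MeasurableSet E → p * (κ₁ a).real E ≤ (κ₀ a).real E)
    (h₁ : ∀ a E, MeasurableSet E → p * (κ₀ a).real E ≤ (κ₁ a).real E) :
    ∃ η₀ η₁ : Kernel α β, IsMarkovKernel η₀ ∧ IsMarkovKernel η₁ ∧ ∀ a E, MeasurableSet E →
      (1 + p) * (κ₀ a).real E = (η₀ a).real E + p * (η₁ a).real E ∧
      (1 + p) * (κ₁ a).real E = p * (η₀ a).real E + (η₁ a).real E := by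
  -- At p = 1 the two bounds give κ₀ = κ₁.
  obtain rfl | hp := hp1.eq_or_lt
  · refine ⟨κ₀, κ₁, inferInstance, inferInstance, fun a E hE => ?_⟩
    have := h₀ a E hE
    have := h₁ a E hE
    constructor <;> linarith
  obtain ⟨η₀, hη₀, e₀⟩ := exists_residual_kernel κ₀ κ₁ hp0 hp1 h₀
  obtain ⟨η₁, hη₁, e₁⟩ := exists_residual_kernel κ₁ κ₀ hp0 hp1 h₁
  refine ⟨η₀, η₁, hη₀, hη₁, fun a E hE => ?_⟩
  have e₀ := e₀ a E hE
  have e₁ := e₁ a E hE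
  have hne : (1 - p) ≠ 0 := by linarith
  constructor <;> apply mul_left_cancel₀ hne
  · linear_combination e₀ + p * e₁
  · linear_combination e₁ + p * e₀

/-- This is `exists_residual_kernel` for the average of the two extremal kernels, which is the law
of a clone. -/
theorem exists_clone_residual (κ η₀ η₁ : Kernel α β) [IsMarkovKernel κ] [IsMarkovKernel η₀]
    [IsMarkovKernel η₁] {p : ℝ} (hp0 : 0 ≤ p) (hp1 : p ≤ 1)
    (h : ∀ a E, MeasurableSet E → p / 2 * ((η₀ a).real E + (η₁ a).real E) ≤ (κ a).real E) :
    ∃ ρ : Kernel α β, IsMarkovKernel ρ ∧ ∀ a E, MeasurableSet E →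
      (κ a).real E =
        p / 2 * (η₀ a).real E + p / 2 * (η₁ a).real E + (1 - p) * (ρ a).real E := by
  have hm : Measurable fun a => (2⁻¹ : ℝ≥0) • (η₀ a + η₁ a) := by
    refine Measure.measurable_of_measurable_coe _ fun E hE => ?_
    simp only [Measure.smul_apply, Measure.add_apply]
    exact ((η₀.measurable_coe hE).add (η₁.measurable_coe hE)).const_smul _
  let η : Kernel α β := ⟨_, hm⟩
  have hη : ∀ a E, (η a E).toReal = 2⁻¹ * ((η₀ a).real E + (η₁ a).real E) := fun a E => by
    have : η a E = (2⁻¹ : ℝ≥0) • (η₀ a E + η₁ a E) := rfl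
    rw [this, ENNReal.smul_def, smul_eq_mul, ENNReal.toReal_mul,
      ENNReal.toReal_add (measure_ne_top _ _) (measure_ne_top _ _)]
    simp [measureReal_def]
  have : IsMarkovKernel η := ⟨fun a => ⟨by
    rw [← ENNReal.toReal_eq_one_iff, hη]
    norm_num⟩⟩
  obtain ⟨ρ, hρ, e⟩ := exists_residual_kernel κ η hp0 hp1 fun a E hE => by
    rw [measureReal_def (μ := η a), hη]
    linarith [h a E hE]
  refine ⟨ρ, hρ, fun a E hE => ?_⟩
  rw [e a E hE, measureReal_def (μ := η a), hη]
  ring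

end Decomposition

/-! ### Words of types and their symmetries -/

section Words

theorem exists_perm_comp_eq {α γ : Type*} [Fintype α] [DecidableEq γ] (f g : α → γ)
    (h : ∀ c, Fintype.card {a // f a = c} = Fintype.card {a // g a = c}) :
    ∃ θ : Equiv.Perm α, ∀ a, g (θ a) = f a :=
  ⟨Equiv.ofFiberEquiv fun c => Fintype.equivOfCardEq (h c), fun a => Equiv.ofFiberEquiv_map _ a⟩

/-- The number of occurrences of the letter `t` in the word `τ`. -/
def occurrences {n : ℕ} {T : Type*} [DecidableEq T] (τ : Fin n → T) (t : T) : ℕ :=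
  ∑ j, if τ j = t then 1 else 0

theorem card_fiber_eq_occurrences {n : ℕ} {T : Type*} [DecidableEq T] (τ : Fin n → T) (t : T) :
    Fintype.card {j // τ j = t} = occurrences τ t := by
  rw [occurrences, Fintype.card_subtype, Finset.card_filter]

theorem occurrences_comp_perm {n : ℕ} {T : Type*} [DecidableEq T] (τ : Fin n → T) (t : T)
    (θ : Equiv.Perm (Fin n)) : occurrences (τ ∘ θ) t = occurrences τ t :=
  Equiv.sum_comp θ fun j => if τ j = t then 1 else 0

theorem sum_occurrences {n : ℕ} {T : Type*} [Fintype T] [DecidableEq T] (τ : Fin n → T) :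
    ∑ t, occurrences τ t = n := by
  simp only [occurrences]
  rw [Finset.sum_comm]
  simp

theorem occurrences_none_eq {n : ℕ} {τ τ' : Fin n → Option Bool}
    (h : ∀ b, occurrences τ (some b) = occurrences τ' (some b)) :
    occurrences τ none = occurrences τ' none := by
  have h1 := sum_occurrences τ
  have h2 := sum_occurrences τ'
  rw [Fintype.sum_option] at h1 h2
  simp only [h] at h1
  omega

/-- Two words with the same letters `none` and the same letter counts differ by a permutation that
fixes the positions of the letters `none`. -/
theorem exists_perm_fixing_none {n : ℕ} (τ τ' : Fin n → Option Bool)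
    (hnone : ∀ j, τ j = none ↔ τ' j = none)
    (hcount : ∀ b, occurrences τ (some b) = occurrences τ' (some b)) :
    ∃ θ : Equiv.Perm (Fin n), (∀ j, τ' (θ j) = τ j) ∧ ∀ j, τ j = none → θ j = j := by
  -- Each position of `none` is its own label, so a label-preserving permutation must fix it.
  let label : (Fin n → Option Bool) → Fin n → Fin n ⊕ Bool :=
    fun τ j => (τ j).elim (Sum.inl j) Sum.inr
  have hl : ∀ τ k j, label τ j = Sum.inl k ↔ τ j = none ∧ j = k := fun τ k j => by
    cases h : τ j <;> simp [label, h]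
  have hr : ∀ τ b j, label τ j = Sum.inr b ↔ τ j = some b := fun τ b j => by
    cases h : τ j <;> simp [label, h]
  obtain ⟨θ, hθ⟩ := exists_perm_comp_eq (label τ) (label τ') fun c => by
    rcases c with k | b
    · refine Fintype.card_congr (Equiv.subtypeEquivRight fun j => ?_)
      rw [hl, hl, hnone]
    · rw [Fintype.card_congr (Equiv.subtypeEquivRight fun j => hr τ b j),
        Fintype.card_congr (Equiv.subtypeEquivRight fun j => hr τ' b j),
        card_fiber_eq_occurrences, card_fiber_eq_occurrences, hcount]
  have hfix : ∀ j, τ j = none → τ' (θ j) = none ∧ θ j = j := fun j hj =>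
    (hl τ' j (θ j)).1 (by rw [hθ, (hl τ j j).2 ⟨hj, rfl⟩])
  refine ⟨θ, fun j => ?_, fun j hj => (hfix j hj).2⟩
  cases h : τ j with
  | none => exact (hfix j h).1
  | some b => exact (hr τ' b (θ j)).1 (by rw [hθ, (hr τ b j).2 h])

/-- Two words with as many letters `none`, none of which is at position `i`, differ in these
letters by a permutation that fixes `i`. -/
theorem exists_perm_fixing_matching_none {n : ℕ} (i : Fin n) (τ τ' : Fin n → Option Bool)
    (hi : τ i ≠ none) (hi' : τ' i ≠ none) (hcount : occurrences τ none = occurrences τ' none) :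
    ∃ θ : Equiv.Perm (Fin n), θ i = i ∧ ∀ j, τ' (θ j) = none ↔ τ j = none := by
  -- The label `some true` is reserved for position `i`, which forces the permutation to fix it;
  -- elsewhere only being `none` or not is recorded.
  let label : (Fin n → Option Bool) → Fin n → Option Bool :=
    fun τ j => if j = i then some true else if τ j = none then none else some false
  have ht : ∀ τ j, label τ j = some true ↔ j = i := fun τ j => by
    simp only [label]; split_ifs <;> simp_all
  have hn : ∀ τ, τ i ≠ none → ∀ j, label τ j = none ↔ τ j = none := fun τ h j => by
    simp only [label]; split_ifs with h1 <;> simp_all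
  have hot : occurrences (label τ) (some true) = occurrences (label τ') (some true) := by
    simp only [occurrences, ht]
  have hon : occurrences (label τ) none = occurrences (label τ') none := by
    simpa only [occurrences, hn τ hi, hn τ' hi'] using hcount
  have hof : occurrences (label τ) (some false) = occurrences (label τ') (some false) := by
    have h1 := sum_occurrences (label τ)
    have h2 := sum_occurrences (label τ')
    rw [Fintype.sum_option, Fintype.sum_bool] at h1 h2
    omega
  obtain ⟨θ, hθ⟩ := exists_perm_comp_eq (label τ) (label τ') fun c => by
    rw [card_fiber_eq_occurrences, card_fiber_eq_occurrences]
    rcases c with _ | _ | _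
    exacts [hon, hof, hot]
  refine ⟨θ, (ht τ' _).1 (by rw [hθ, ht]), fun j => ?_⟩
  rw [← hn τ' hi', hθ, hn τ hi]

end Words

/-! ### The shuffled law of a word -/

section Shuffle

variable {n : ℕ} {S : Fin n → Type*} [∀ i, MeasurableSpace (S i)]
  (G : (i : Fin n) → Fin n → Option Bool → Kernel (Prefix S i i.isLt.le) (S i))

/-- The output law when record `j` is replaced by the randomizer `G · j (τ j)` and the records are
shuffled. -/
noncomputable def wordLaw (τ : Fin n → Option Bool) : Measure ((i : Fin n) → S i) :=
  ∑ π : Equiv.Perm (Fin n), (n.factorial : ℝ≥0∞)⁻¹ •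
    sequentialLaw (fun i => G i (π i) (τ (π i)))

instance isProbabilityMeasure_wordLaw [∀ i j t, IsMarkovKernel (G i j t)]
    (τ : Fin n → Option Bool) : IsProbabilityMeasure (wordLaw G τ) := by
  refine ⟨?_⟩
  have (π : Equiv.Perm (Fin n)) :
      IsProbabilityMeasure (sequentialLaw (fun i => G i (π i) (τ (π i)))) :=
    isProbabilityMeasure_prefixLaw _ _ _
  rw [wordLaw, Measure.finsetSum_apply]
  simp only [Measure.smul_apply, measure_univ, smul_eq_mul, mul_one, Finset.sum_const,
    Finset.card_univ, Fintype.card_perm, Fintype.card_fin, nsmul_eq_mul]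
  exact ENNReal.mul_inv_cancel (by simp [Nat.factorial_ne_zero]) (by simp)

/-- Clone kernels do not depend on the record, so clone letters may be permuted by θ and θ absorbed
into the uniform π. Residual kernels do depend on it, so θ has to fix the letters `none`. -/
theorem wordLaw_congr (hG : ∀ i j j' b, G i j (some b) = G i j' (some b))
    (τ τ' : Fin n → Option Bool) (hnone : ∀ j, τ j = none ↔ τ' j = none)
    (hcount : ∀ b, occurrences τ (some b) = occurrences τ' (some b)) :
    wordLaw G τ = wordLaw G τ' := by
  obtain ⟨θ, hθ, hfix⟩ := exists_perm_fixing_none τ τ' hnone hcount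
  rw [wordLaw, wordLaw, ← Equiv.sum_comp (Equiv.mulLeft θ) fun π =>
    (n.factorial : ℝ≥0∞)⁻¹ • sequentialLaw (fun i => G i (π i) (τ' (π i)))]
  refine Finset.sum_congr rfl fun π _ => ?_
  congr 2
  ext1 i
  simp only [Equiv.coe_mulLeft, Equiv.Perm.mul_apply, hθ]
  cases h : τ (π i) with
  | none => rw [hfix _ h]
  | some b => exact hG _ _ _ _

/-- The average of `wordLaw` over all permutations of the records other than `i`. -/
noncomputable def averagedWordLaw (i : Fin n) (τ : Fin n → Option Bool) : Measure ((i : Fin n) → S i) :=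
  ∑ θ : MulAction.stabilizer (Equiv.Perm (Fin n)) i,
    (Fintype.card (MulAction.stabilizer (Equiv.Perm (Fin n)) i) : ℝ≥0∞)⁻¹ •
      wordLaw G (τ ∘ (θ : Equiv.Perm (Fin n)))

instance isProbabilityMeasure_averagedWordLaw [∀ i j t, IsMarkovKernel (G i j t)]
    (i : Fin n) (τ : Fin n → Option Bool) : IsProbabilityMeasure (averagedWordLaw G i τ) := by
  refine ⟨?_⟩
  rw [averagedWordLaw, Measure.finsetSum_apply]
  simp only [Measure.smul_apply, measure_univ, smul_eq_mul, mul_one, Finset.sum_const,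
    Finset.card_univ, nsmul_eq_mul]
  exact ENNReal.mul_inv_cancel (Nat.cast_ne_zero.2 Fintype.card_ne_zero) (by simp)

/-- Averaging removes the remaining dependence on which records are residual: a permutation fixing
`i` matches the letters `none` of the two words and is absorbed into the average, after which
`wordLaw_congr` applies. -/
theorem averagedWordLaw_congr (hG : ∀ i j j' b, G i j (some b) = G i j' (some b)) (i : Fin n)
    (τ τ' : Fin n → Option Bool) (hi : τ i ≠ none) (hi' : τ' i ≠ none)
    (hcount : ∀ b, occurrences τ (some b) = occurrences τ' (some b)) :
    averagedWordLaw G i τ = averagedWordLaw G i τ' := by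
  obtain ⟨ρ, hρ, hnone⟩ :=
    exists_perm_fixing_matching_none i τ τ' hi hi' (occurrences_none_eq hcount)
  let ρ' : MulAction.stabilizer (Equiv.Perm (Fin n)) i := ⟨ρ, hρ⟩
  rw [averagedWordLaw, averagedWordLaw, ← Equiv.sum_comp (Equiv.mulLeft ρ') fun θ => _ •
    wordLaw G (τ' ∘ (θ : Equiv.Perm (Fin n)))]
  refine Finset.sum_congr rfl fun θ _ => ?_
  congr 1
  refine wordLaw_congr G hG _ _ (fun j => (hnone _).symm) fun b => ?_
  rw [occurrences_comp_perm, occurrences_comp_perm, hcount]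

/-- Weights that are invariant under the permutations fixing `i` do not see the averaging. -/
theorem sum_smul_averagedWordLaw (i : Fin n) (W : (Fin n → Option Bool) → ℝ≥0∞)
    (hW : ∀ θ : Equiv.Perm (Fin n), θ i = i → ∀ τ, W (τ ∘ θ) = W τ) :
    ∑ τ, W τ • averagedWordLaw G i τ = ∑ τ, W τ • wordLaw G τ := by
  simp only [averagedWordLaw, Finset.smul_sum]
  rw [Finset.sum_comm]
  set c := (Fintype.card (MulAction.stabilizer (Equiv.Perm (Fin n)) i) : ℝ≥0∞) with hc
  have h : ∀ θ : MulAction.stabilizer (Equiv.Perm (Fin n)) i,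
      ∑ τ, W τ • c⁻¹ • wordLaw G (τ ∘ (θ : Equiv.Perm (Fin n))) =
        c⁻¹ • ∑ τ, W τ • wordLaw G τ := fun θ => by
    rw [Finset.smul_sum, ← (Equiv.arrowCongr (θ : Equiv.Perm (Fin n)).symm
      (Equiv.refl (Option Bool))).sum_comp (fun τ => c⁻¹ • W τ • wordLaw G τ)]
    refine Finset.sum_congr rfl fun τ _ => ?_
    have : (Equiv.arrowCongr (θ : Equiv.Perm (Fin n)).symm (Equiv.refl (Option Bool))) τ
      = τ ∘ (θ : Equiv.Perm (Fin n)) := rfl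
    rw [this, hW _ θ.2, smul_comm]
  rw [Finset.sum_congr rfl fun θ _ => h θ, Finset.sum_const, ← Nat.cast_smul_eq_nsmul ℝ≥0∞,
    smul_smul, Finset.card_univ, ← hc,
    ENNReal.mul_inv_cancel (Nat.cast_ne_zero.2 Fintype.card_ne_zero) (by simp), one_smul]

/-- If record `j` is randomized by a mixture of the `G · j t` with weights `w j t`, then the
shuffled process is the mixture of the laws of all words. -/
theorem shuffledProcess_eq_sum_wordLaw {D : Type*} [∀ i j t, IsMarkovKernel (G i j t)]
    (R : (i : Fin n) → D → Kernel (Prefix S i i.isLt.le) (S i)) [∀ i x, IsMarkovKernel (R i x)]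
    (X : Fin n → D) (w : Fin n → Option Bool → ℝ≥0∞)
    (h : ∀ i j z, R i (X j) z = ∑ t, w j t • G i j t z) :
    shuffledProcess R X = ∑ τ, (∏ j, w j (τ j)) • wordLaw G τ := by
  simp only [shuffledProcess, wordLaw, Finset.smul_sum]
  rw [Finset.sum_comm]
  refine Finset.sum_congr rfl fun π _ => ?_
  rw [adaptiveProcess, sequentialLaw_mixture (fun i => w (π i)) (fun i => G i (π i)) _
    (fun i z => h i (π i) z), Finset.smul_sum,
    -- Letters are indexed by output position in `sequentialLaw_mixture` but by record in `wordLaw`;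
    -- π translates between the two.
    ← (Equiv.arrowCongr π.symm (Equiv.refl (Option Bool))).sum_comp]
  refine Finset.sum_congr rfl fun τ _ => ?_
  rw [smul_comm]
  congr 1
  exact Equiv.prod_comp π fun j => w j (τ j)

end Shuffle

/-! ### The laws of the counts -/

section Counts

/-- The expectation of `f (k, m - k)` when `k` is binomially distributed, with success and failure
weights `p` and `q`. -/
noncomputable def binomialSum (p q : ℝ≥0∞) (m : ℕ) (f : ℕ → ℕ → ℝ≥0∞) : ℝ≥0∞ :=
  ∑ ij ∈ Finset.HasAntidiagonal.antidiagonal m, m.choose ij.1 • (p ^ ij.1 * q ^ ij.2 * f ij.1 ij.2)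

theorem binomialSum_zero (p q : ℝ≥0∞) (f : ℕ → ℕ → ℝ≥0∞) : binomialSum p q 0 f = f 0 0 := by
  simp [binomialSum]

/-- Pascal's rule, that is, conditioning on one trial. -/
theorem binomialSum_succ (p q : ℝ≥0∞) (m : ℕ) (f : ℕ → ℕ → ℝ≥0∞) :
    binomialSum p q (m + 1) f = p * binomialSum p q m (fun i j => f (i + 1) j) +
      q * binomialSum p q m (fun i j => f i (j + 1)) := by
  rw [binomialSum, Finset.sum_antidiagonal_choose_succ_nsmul
    (fun i j => p ^ i * q ^ j * f i j), add_comm, binomialSum, binomialSum, Finset.mul_sum,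
    Finset.mul_sum]
  congr 1
  · refine Finset.sum_congr rfl fun ij hij => ?_
    rw [← Finset.HasAntidiagonal.mem_antidiagonal.1 hij, Nat.choose_symm_add]
    simp only [nsmul_eq_mul]
    ring
  · refine Finset.sum_congr rfl fun ij hij => ?_
    simp only [nsmul_eq_mul]
    ring

theorem binomialSum_add (p q : ℝ≥0∞) (m : ℕ) (f g : ℕ → ℕ → ℝ≥0∞) :
    binomialSum p q m (fun i j => f i j + g i j) = binomialSum p q m f + binomialSum p q m g := by
  simp only [binomialSum, ← Finset.sum_add_distrib, mul_add, smul_add]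

theorem binomialSum_const_mul (p q c : ℝ≥0∞) (m : ℕ) (f : ℕ → ℕ → ℝ≥0∞) :
    binomialSum p q m (fun i j => c * f i j) = c * binomialSum p q m f := by
  rw [binomialSum, binomialSum, Finset.mul_sum]
  refine Finset.sum_congr rfl fun ij _ => ?_
  simp only [nsmul_eq_mul]
  ring

theorem lintegral_binomial (m : ℕ) (p : I) (f : ℕ → ℝ≥0∞) :
    ∫⁻ k, f k ∂(binomial m p) =
      binomialSum (unitInterval.toNNReal p) (unitInterval.toNNReal (unitInterval.symm p)) m
        (fun k _ => f k) := by
  rw [binomial_eq_sum_dirac, lintegral_finsetSum_measure, binomialSum,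
    Finset.Nat.sum_antidiagonal_eq_sum_range_succ_mk, Nat.range_succ_eq_Iic]
  refine Finset.sum_congr rfl fun k _ => ?_
  have hp := p.2.1
  have hq : (0 : ℝ) ≤ 1 - p := sub_nonneg.2 p.2.2
  rw [lintegral_smul_measure, lintegral_dirac, smul_eq_mul, nsmul_eq_mul,
    ENNReal.ofReal_mul (by positivity), ENNReal.ofReal_mul (by positivity),
    ENNReal.ofReal_pow hp, ENNReal.ofReal_pow hq, ENNReal.ofReal_natCast]
  have h1 : ENNReal.ofReal p = unitInterval.toNNReal p := by
    rw [ENNReal.ofReal]; congr 1; ext; simp [hp]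
  have h2 : ENNReal.ofReal (1 - p) = unitInterval.toNNReal (unitInterval.symm p) := by
    rw [ENNReal.ofReal]; congr 1; ext; simp [hq]
  rw [h1, h2]
  ring

theorem binomialSum_congr (p q : ℝ≥0∞) (m : ℕ) {f g : ℕ → ℕ → ℝ≥0∞}
    (h : ∀ i j, i + j = m → f i j = g i j) : binomialSum p q m f = binomialSum p q m g :=
  Finset.sum_congr rfl fun ij hij => by rw [h _ _ (Finset.HasAntidiagonal.mem_antidiagonal.1 hij)]

/-- The weights of a record that is a clone of either type with probability `h`. -/
def cloneWeight (h q : ℝ≥0∞) : Option Bool → ℝ≥0∞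
  | none => q
  | some _ => h

@[simp]
theorem cloneWeight_none (h q : ℝ≥0∞) : cloneWeight h q none = q := rfl

@[simp]
theorem cloneWeight_some (h q : ℝ≥0∞) (b : Bool) : cloneWeight h q (some b) = h := rfl

/-- The weights of the distinguished record, which has the type `true` or `false` with probability
`f` or `g`. -/
def headWeight (f g : ℝ≥0∞) : Option Bool → ℝ≥0∞
  | none => 0
  | some true => f
  | some false => g

/-- The weights `v` for the record `i` and `w` for all other ones. -/
def recordWeight {n : ℕ} {T : Type*} (i : Fin n) (v w : T → ℝ≥0∞) (j : Fin n) : T → ℝ≥0∞ :=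
  if j = i then v else w

/-- Conditioning on the letter at `i`, which isolates the distinguished record from the identically
weighted others. -/
theorem sum_words_succAbove {m : ℕ} {T : Type*} [Fintype T] [DecidableEq T] (i : Fin (m + 1))
    (v w : T → ℝ≥0∞) (F : (T → ℕ) → ℝ≥0∞) :
    ∑ τ : Fin (m + 1) → T, (∏ j, recordWeight i v w j (τ j)) * F (occurrences τ) =
      ∑ t, v t * ∑ τ : Fin m → T, (∏ j, w (τ j)) *
        F (fun s => occurrences τ s + if t = s then 1 else 0) := by
  rw [← (Fin.insertNthEquiv (fun _ : Fin (m + 1) => T) i).sum_comp, Fintype.sum_prod_type]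
  refine Finset.sum_congr rfl fun t _ => ?_
  rw [Finset.mul_sum]
  refine Finset.sum_congr rfl fun τ _ => ?_
  rw [Fin.prod_univ_succAbove _ i, ← mul_assoc]
  have hocc : occurrences (Fin.insertNthEquiv (fun _ : Fin (m + 1) => T) i (t, τ)) =
      fun s => occurrences τ s + if t = s then 1 else 0 := by
    ext s
    simp [occurrences, Fin.sum_univ_succAbove _ i, add_comm]
  rw [hocc]
  simp [recordWeight]

/-- Independent letters can be drawn in two stages: first which ones are clones, then the type of
each clone. The identity is polynomial, so the weights need not sum to one. -/
theorem sum_words_cloneWeight (c q p : ℝ≥0∞) (m : ℕ) (F : ℕ → ℕ → ℝ≥0∞) :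
    ∑ τ : Fin m → Option Bool, (∏ j, cloneWeight (c * p) q (τ j)) *
      F (occurrences τ (some true)) (occurrences τ (some false)) =
    binomialSum c q m (fun k _ => binomialSum p p k F) := by
  induction m generalizing F with
  | zero => simp [binomialSum_zero, occurrences]
  | succ m ih =>
    have h := sum_words_succAbove (0 : Fin (m + 1)) (cloneWeight (c * p) q)
      (cloneWeight (c * p) q) (fun o => F (o (some true)) (o (some false)))
    simp only [recordWeight, ite_self] at h
    rw [h, Fintype.sum_option, Fintype.sum_bool]
    have h1 := ih fun a b => F (a + 1) b
    have h2 := ih fun a b => F a (b + 1)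
    simp [h1, h2, ih, binomialSum_succ, binomialSum_add, binomialSum_const_mul]
    ring

theorem sum_words_recordWeight (f g c q p : ℝ≥0∞) {m : ℕ} (i : Fin (m + 1))
    (F : ℕ → ℕ → ℝ≥0∞) :
    ∑ τ : Fin (m + 1) → Option Bool,
      (∏ j, recordWeight i (headWeight f g) (cloneWeight (c * p) q) j (τ j)) *
        F (occurrences τ (some true)) (occurrences τ (some false)) =
    binomialSum c q m (fun k _ => binomialSum p p k
      fun a b => f * F (a + 1) b + g * F a (b + 1)) := by
  rw [sum_words_succAbove i _ _ (fun o => F (o (some true)) (o (some false))),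
    Fintype.sum_option, Fintype.sum_bool]
  have h1 := sum_words_cloneWeight c q p m fun a b => F (a + 1) b
  have h2 := sum_words_cloneWeight c q p m fun a b => F a (b + 1)
  simp [h1, h2, headWeight, binomialSum_add, binomialSum_const_mul]

theorem lintegral_countLaw (n : ℕ) (ε₀ : ℝ≥0) (F : ℕ × ℕ → ℝ≥0∞) :
    ∫⁻ x, F x ∂(countLaw n ε₀) =
      binomialSum (unitInterval.toNNReal (cloneProb ε₀))
        (unitInterval.toNNReal (unitInterval.symm (cloneProb ε₀))) (n - 1)
        (fun c _ => binomialSum (unitInterval.toNNReal halfProb)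
          (unitInterval.toNNReal halfProb) c (fun a _ => F (c, a))) := by
  have hs : unitInterval.symm halfProb = halfProb := by
    ext; simp [halfProb]; norm_num
  rw [countLaw, Measure.lintegral_bind Measurable.of_discrete.aemeasurable
    Measurable.of_discrete.aemeasurable, lintegral_binomial]
  simp_rw [lintegral_map (Measurable.of_discrete (f := F)) Measurable.of_discrete,
    lintegral_binomial, hs]

theorem lintegral_countFlipLaw (n : ℕ) (ε₀ : ℝ≥0) (F : (ℕ × ℕ) × ℕ → ℝ≥0∞) :
    ∫⁻ x, F x ∂(countFlipLaw n ε₀) =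
      binomialSum (unitInterval.toNNReal (cloneProb ε₀))
        (unitInterval.toNNReal (unitInterval.symm (cloneProb ε₀))) (n - 1)
        (fun c _ => binomialSum (unitInterval.toNNReal halfProb)
          (unitInterval.toNNReal halfProb) c (fun a _ =>
            unitInterval.toNNReal (flipProb ε₀) * F ((c, a), 1) +
            unitInterval.toNNReal (unitInterval.symm (flipProb ε₀)) * F ((c, a), 0))) := by
  rw [countFlipLaw, lintegral_prod _ Measurable.of_discrete.aemeasurable, lintegral_countLaw]
  simp_rw [bernoulliMeasure_def, lintegral_add_measure, lintegral_smul_measure, lintegral_dirac,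
    ENNReal.smul_def, smul_eq_mul]

/-- The weights of the types of the records, `f` and `g` being the probabilities that the
distinguished record `i` has the type `true` or `false`. -/
noncomputable def typeWeight {n : ℕ} (ε₀ : ℝ≥0) (i : Fin n) (f g : ℝ≥0∞) :
    Fin n → Option Bool → ℝ≥0∞ :=
  recordWeight i (headWeight f g)
    (cloneWeight (unitInterval.toNNReal (cloneProb ε₀) * unitInterval.toNNReal halfProb)
      (unitInterval.toNNReal (unitInterval.symm (cloneProb ε₀))))

/-- P is the law of the type counts of a random word, with Δ = 1 meaning that the distinguished
record has type `true`. For Q the two types of that record are exchanged. -/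
theorem lintegral_lawP {m : ℕ} (ε₀ : ℝ≥0) (i : Fin (m + 1)) (F : ℕ × ℕ → ℝ≥0∞) :
    ∫⁻ x, F x ∂(lawP (m + 1) ε₀) = ∑ τ : Fin (m + 1) → Option Bool,
      (∏ j, typeWeight ε₀ i (unitInterval.toNNReal (flipProb ε₀))
        (unitInterval.toNNReal (unitInterval.symm (flipProb ε₀))) j (τ j)) *
        F (occurrences τ (some true), occurrences τ (some false)) := by
  rw [lawP, lintegral_map Measurable.of_discrete Measurable.of_discrete, lintegral_countFlipLaw,
    add_tsub_cancel_right]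
  simp only [typeWeight]
  rw [sum_words_recordWeight _ _ _ _ _ i fun a b => F (a, b)]
  refine binomialSum_congr _ _ _ fun c _ _ => binomialSum_congr _ _ _ fun a b hab => ?_
  -- With `c = a + b` the truncated subtractions evaluate exactly.
  subst hab
  simp

theorem lintegral_lawQ {m : ℕ} (ε₀ : ℝ≥0) (i : Fin (m + 1)) (F : ℕ × ℕ → ℝ≥0∞) :
    ∫⁻ x, F x ∂(lawQ (m + 1) ε₀) = ∑ τ : Fin (m + 1) → Option Bool,
      (∏ j, typeWeight ε₀ i (unitInterval.toNNReal (unitInterval.symm (flipProb ε₀)))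
        (unitInterval.toNNReal (flipProb ε₀)) j (τ j)) *
        F (occurrences τ (some true), occurrences τ (some false)) := by
  rw [lawQ, lintegral_map Measurable.of_discrete Measurable.of_discrete, lintegral_countFlipLaw,
    add_tsub_cancel_right]
  simp only [typeWeight]
  rw [sum_words_recordWeight _ _ _ _ _ i fun a b => F (a, b)]
  refine binomialSum_congr _ _ _ fun c _ _ => binomialSum_congr _ _ _ fun a b hab => ?_
  subst hab
  simp [add_comm]

end Counts

/-! ### Reduction to the counts -/

section Reduction

theorem prod_typeWeight_comp_perm {n : ℕ} (ε₀ : ℝ≥0) (i : Fin n) (f g : ℝ≥0∞)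
    (θ : Equiv.Perm (Fin n)) (hθ : θ i = i) (τ : Fin n → Option Bool) :
    ∏ j, typeWeight ε₀ i f g j ((τ ∘ θ) j) = ∏ j, typeWeight ε₀ i f g j (τ j) := by
  rw [← Equiv.prod_comp θ fun j => typeWeight ε₀ i f g j (τ j)]
  refine Finset.prod_congr rfl fun j _ => ?_
  have : θ j = i ↔ j = i := by rw [← θ.injective.eq_iff (a := j), hθ]
  simp [typeWeight, recordWeight, this]

theorem prod_typeWeight_eq_zero {n : ℕ} (ε₀ : ℝ≥0) (i : Fin n) (f g : ℝ≥0∞)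
    (τ : Fin n → Option Bool) (hτ : τ i = none) :
    ∏ j, typeWeight ε₀ i f g j (τ j) = 0 :=
  Finset.prod_eq_zero (Finset.mem_univ i) (by simp [typeWeight, recordWeight, headWeight, hτ])

variable {n : ℕ} {S : Fin n → Type*} [∀ i, MeasurableSpace (S i)]
  (G : (i : Fin n) → Fin n → Option Bool → Kernel (Prefix S i i.isLt.le) (S i))

/-- The numbers of records of the types `true` and `false`. -/
def typeCounts (τ : Fin n → Option Bool) : ℕ × ℕ :=
  (occurrences τ (some true), occurrences τ (some false))

open Classical in
/-- The output law given the numbers of records of the types `true` and `false`. -/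
noncomputable def countsLaw (i : Fin n) (k : ℕ × ℕ) : Measure ((i : Fin n) → S i) :=
  if h : ∃ τ : Fin n → Option Bool, τ i ≠ none ∧ typeCounts τ = k
    then averagedWordLaw G i h.choose else 0

theorem countsLaw_univ_le_one [∀ i j t, IsMarkovKernel (G i j t)] (i : Fin n) (k : ℕ × ℕ) :
    countsLaw G i k Set.univ ≤ 1 := by
  rw [countsLaw]
  split_ifs
  · exact prob_le_one
  · simp

/-- The word chosen in `countsLaw` is immaterial by `averagedWordLaw_congr`. Words with `none` at
`i` are excluded; they carry weight zero. -/
theorem countsLaw_typeCounts (hG : ∀ i j j' b, G i j (some b) = G i j' (some b)) (i : Fin n)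
    (τ : Fin n → Option Bool) (hτ : τ i ≠ none) :
    countsLaw G i (typeCounts τ) = averagedWordLaw G i τ := by
  have h : ∃ τ' : Fin n → Option Bool, τ' i ≠ none ∧ typeCounts τ' = typeCounts τ := ⟨τ, hτ, rfl⟩
  rw [countsLaw, dif_pos h]
  have hc := h.choose_spec.2
  refine averagedWordLaw_congr G hG i _ _ h.choose_spec.1 hτ fun b => ?_
  cases b
  · exact congrArg Prod.snd hc
  · exact congrArg Prod.fst hc

/-- The mixture of the word laws is a mixture of the laws given the counts, with the law `P` of the
counts as its mixing distribution. -/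
theorem sum_typeWeight_wordLaw (hG : ∀ i j j' b, G i j (some b) = G i j' (some b)) (ε₀ : ℝ≥0)
    (i : Fin n) (f g : ℝ≥0∞) (P : Measure (ℕ × ℕ))
    (hP : ∀ F : ℕ × ℕ → ℝ≥0∞, ∫⁻ x, F x ∂P =
      ∑ τ : Fin n → Option Bool, (∏ j, typeWeight ε₀ i f g j (τ j)) * F (typeCounts τ)) :
    ∑ τ, (∏ j, typeWeight ε₀ i f g j (τ j)) • wordLaw G τ =
      ∑ k ∈ Finset.univ.image (typeCounts (n := n)), P {k} • countsLaw G i k := by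
  rw [← sum_smul_averagedWordLaw G i _ (fun θ hθ τ => prod_typeWeight_comp_perm ε₀ i f g θ hθ τ)]
  have h1 : ∀ τ : Fin n → Option Bool,
      (∏ j, typeWeight ε₀ i f g j (τ j)) • averagedWordLaw G i τ =
        (∏ j, typeWeight ε₀ i f g j (τ j)) • countsLaw G i (typeCounts τ) := fun τ => by
    by_cases hτ : τ i = none
    · rw [prod_typeWeight_eq_zero ε₀ i f g τ hτ, zero_smul, zero_smul]
    · rw [countsLaw_typeCounts G hG i τ hτ]
  rw [Finset.sum_congr rfl fun τ _ => h1 τ, ← Finset.sum_fiberwise_of_maps_to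
    (fun τ _ => Finset.mem_image_of_mem (typeCounts (n := n)) (Finset.mem_univ τ))]
  refine Finset.sum_congr rfl fun k _ => ?_
  -- Testing `hP` on the indicator of `k` gives the total weight of the words with counts `k`.
  have hPk : P {k} = ∑ τ with typeCounts (n := n) τ = k, ∏ j, typeWeight ε₀ i f g j (τ j) := by
    rw [← lintegral_indicator_one (measurableSet_singleton k), hP, Finset.sum_filter]
    refine Finset.sum_congr rfl fun τ _ => ?_
    by_cases h : typeCounts τ = k <;> simp [h]
  rw [hPk, Finset.sum_smul]
  refine Finset.sum_congr rfl fun τ hτ => ?_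
  rw [(Finset.mem_filter.1 hτ).2]

end Reduction

/-! ### Clone decomposition of LDP randomizers -/

section LDP

/-- Reduces mixture identities between measures to linear arithmetic over the reals. -/
theorem measure_eq_mixture_of_real {Ω : Type*} [MeasurableSpace Ω]
    (μ μ₁ μ₂ μ₃ : Measure Ω) [IsFiniteMeasure μ] [IsFiniteMeasure μ₁] [IsFiniteMeasure μ₂]
    [IsFiniteMeasure μ₃] (a b c : ℝ≥0)
    (h : ∀ E, MeasurableSet E →
      μ.real E = a * μ₁.real E + b * μ₂.real E + c * μ₃.real E) :
    μ = (a : ℝ≥0∞) • μ₁ + (b : ℝ≥0∞) • μ₂ + (c : ℝ≥0∞) • μ₃ := by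
  ext E hE
  simp only [Measure.add_apply, Measure.smul_apply, smul_eq_mul]
  rw [← ENNReal.toReal_eq_toReal_iff' (by finiteness) (by finiteness),
    ENNReal.toReal_add (by finiteness) (by finiteness),
    ENNReal.toReal_add (by finiteness) (by finiteness)]
  simpa [measureReal_def] using h E hE

theorem IsLDP.exp_neg_mul_real_le {D Ω : Type*} [MeasurableSpace Ω] {ε : ℝ} {M : D → Measure Ω}
    [∀ x, IsFiniteMeasure (M x)] (h : IsLDP ε M) (x x' : D) {E : Set Ω} (hE : MeasurableSet E) :
    Real.exp (-ε) * (M x).real E ≤ (M x').real E := by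
  have h1 := ENNReal.toReal_mono (by finiteness) (h x x' E hE)
  rw [ENNReal.toReal_mul, ENNReal.toReal_ofReal (Real.exp_pos _).le] at h1
  rw [Real.exp_neg, inv_mul_le_iff₀ (Real.exp_pos _)]
  exact h1

variable {n : ℕ} {D : Type*} {S : Fin n → Type*} [∀ i, MeasurableSpace (S i)]

/-- Local randomizers that are LDP decompose into clones of two extremal kernels and
remainders. -/
theorem exists_clone_decomposition (ε₀ : ℝ≥0)
    (R : (i : Fin n) → D → Kernel (Prefix S i i.isLt.le) (S i)) [∀ i x, IsMarkovKernel (R i x)]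
    (hR : ∀ i z, IsLDP (ε₀ : ℝ) (fun x => R i x z)) (X₀ X₁ : Fin n → D) (i₀ : Fin n)
    (hX : ∀ j, j ≠ i₀ → X₀ j = X₁ j) :
    ∃ G : (i : Fin n) → Fin n → Option Bool → Kernel (Prefix S i i.isLt.le) (S i),
      (∀ i j t, IsMarkovKernel (G i j t)) ∧
      (∀ i j j' b, G i j (some b) = G i j' (some b)) ∧
      (∀ i j z, R i (X₀ j) z = ∑ t, typeWeight ε₀ i₀ (unitInterval.toNNReal (flipProb ε₀))
        (unitInterval.toNNReal (unitInterval.symm (flipProb ε₀))) j t • G i j t z) ∧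
      (∀ i j z, R i (X₁ j) z =
        ∑ t, typeWeight ε₀ i₀ (unitInterval.toNNReal (unitInterval.symm (flipProb ε₀)))
          (unitInterval.toNNReal (flipProb ε₀)) j t • G i j t z) := by
  have hp0 : 0 < Real.exp (-ε₀ : ℝ) := Real.exp_pos _
  have hp1 : Real.exp (-ε₀ : ℝ) ≤ 1 := (cloneProb ε₀).2.2
  have hle : ∀ i x x' z E, MeasurableSet E →
      Real.exp (-ε₀ : ℝ) * (R i x z).real E ≤ (R i x' z).real E := fun i x x' z E hE =>
    (hR i z).exp_neg_mul_real_le x x' hE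
  choose η₀ η₁ hη₀ hη₁ hη using fun i => exists_extremal_kernels (R i (X₀ i₀)) (R i (X₁ i₀))
    hp0.le hp1 (hle i _ _) (hle i _ _)
  have hsum : ∀ i z E, MeasurableSet E →
      (η₀ i z).real E + (η₁ i z).real E = (R i (X₀ i₀) z).real E + (R i (X₁ i₀) z).real E := by
    intro i z E hE
    have := hη i z E hE
    refine mul_left_cancel₀ (by positivity : (1 + Real.exp (-ε₀ : ℝ)) ≠ 0) ?_
    linear_combination -this.1 - this.2
  -- Averaging the LDP bounds against both values of the differing record gives (p/2)(κ₀ + κ₁) ≤ `R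
  -- i x`, and κ₀ + κ₁ = η₀ + η₁.
  choose ρ hρ hρe using fun i x => exists_clone_residual (R i x) (η₀ i) (η₁ i) hp0.le hp1
    fun z E hE => by
      rw [hsum i z E hE]
      linarith [hle i (X₀ i₀) x z E hE, hle i (X₁ i₀) x z E hE]
  have hclone : ∀ i x z, R i x z =
      ((unitInterval.toNNReal (cloneProb ε₀) * unitInterval.toNNReal halfProb : ℝ≥0) : ℝ≥0∞) •
        η₀ i z +
      ((unitInterval.toNNReal (cloneProb ε₀) * unitInterval.toNNReal halfProb : ℝ≥0) : ℝ≥0∞) •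
        η₁ i z +
      (unitInterval.toNNReal (unitInterval.symm (cloneProb ε₀)) : ℝ≥0∞) • ρ i x z :=
    fun i x z => measure_eq_mixture_of_real _ _ _ _ _ _ _ fun E hE => by
      rw [hρe i x z E hE]
      simp [cloneProb, halfProb]
      ring
  have hhead₀ : ∀ i z, R i (X₀ i₀) z =
      (unitInterval.toNNReal (flipProb ε₀) : ℝ≥0∞) • η₀ i z +
        (unitInterval.toNNReal (unitInterval.symm (flipProb ε₀)) : ℝ≥0∞) • η₁ i z := by
    intro i z
    have := measure_eq_mixture_of_real (R i (X₀ i₀) z) (η₀ i z) (η₁ i z) 0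
      (unitInterval.toNNReal (flipProb ε₀))
      (unitInterval.toNNReal (unitInterval.symm (flipProb ε₀))) 0 fun E hE => by
        have := (hη i z E hE).1
        simp only [unitInterval.coe_toNNReal, unitInterval.coe_symm_eq, flipProb]
        field_simp
        simp
        linear_combination this
    simpa using this
  have hhead₁ : ∀ i z, R i (X₁ i₀) z =
      (unitInterval.toNNReal (unitInterval.symm (flipProb ε₀)) : ℝ≥0∞) • η₀ i z +
        (unitInterval.toNNReal (flipProb ε₀) : ℝ≥0∞) • η₁ i z := by
    intro i z
    have := measure_eq_mixture_of_real (R i (X₁ i₀) z) (η₀ i z) (η₁ i z) 0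
      (unitInterval.toNNReal (unitInterval.symm (flipProb ε₀)))
      (unitInterval.toNNReal (flipProb ε₀)) 0 fun E hE => by
        have := (hη i z E hE).2
        simp only [unitInterval.coe_toNNReal, unitInterval.coe_symm_eq, flipProb]
        field_simp
        simp
        linear_combination this
    simpa using this
  -- One family serves both data sets: they agree off `i₀`, and at `i₀` the residual has weight
  -- zero.
  let G : (i : Fin n) → Fin n → Option Bool → Kernel (Prefix S i i.isLt.le) (S i) :=
    fun i j t => match t with
      | none => ρ i (X₀ j)
      | some true => η₀ i
      | some false => η₁ i
  refine ⟨G, ?_, ?_, ?_, ?_⟩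
  · rintro i j (_ | _ | _)
    exacts [hρ i (X₀ j), hη₁ i, hη₀ i]
  · rintro i j j' (_ | _) <;> rfl
  · intro i j z
    rw [Fintype.sum_option, Fintype.sum_bool, add_comm]
    by_cases hj : j = i₀
    · subst hj
      simpa [typeWeight, recordWeight, headWeight, G] using hhead₀ i z
    · simpa [typeWeight, recordWeight, hj, G] using hclone i (X₀ j) z
  · intro i j z
    rw [Fintype.sum_option, Fintype.sum_bool, add_comm]
    by_cases hj : j = i₀
    · subst hj
      simpa [typeWeight, recordWeight, headWeight, G] using hhead₁ i z
    · rw [← hX j hj]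
      simpa [typeWeight, recordWeight, hj, G] using hclone i (X₀ j) z

end LDP

/-! ### Normalization of the count laws -/

instance isProbabilityMeasure_countLaw (n : ℕ) (ε₀ : ℝ≥0) :
    IsProbabilityMeasure (countLaw n ε₀) :=
  isProbabilityMeasure_bind Measurable.of_discrete.aemeasurable
    (.of_forall fun _ => Measure.isProbabilityMeasure_map Measurable.of_discrete.aemeasurable)

instance isProbabilityMeasure_countFlipLaw (n : ℕ) (ε₀ : ℝ≥0) :
    IsProbabilityMeasure (countFlipLaw n ε₀) := by
  unfold countFlipLaw; infer_instance

instance isProbabilityMeasure_lawP (n : ℕ) (ε₀ : ℝ≥0) : IsProbabilityMeasure (lawP n ε₀) :=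
  Measure.isProbabilityMeasure_map Measurable.of_discrete.aemeasurable

instance isProbabilityMeasure_lawQ (n : ℕ) (ε₀ : ℝ≥0) : IsProbabilityMeasure (lawQ n ε₀) :=
  Measure.isProbabilityMeasure_map Measurable.of_discrete.aemeasurable

end ShuffleRDP

theorem corollary1 {n : ℕ} (hn : 1 ≤ n) {D : Type*} {S : Fin n → Type*}
    [∀ i, MeasurableSpace (S i)] (ε₀ : ℝ≥0) (lam : ℝ) (hlam : 1 < lam)
    (R : (i : Fin n) → D → Kernel (ShuffleRDP.Prefix S i i.isLt.le) (S i))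
    [∀ i x, IsMarkovKernel (R i x)]
    (hR : ∀ (i : Fin n) (z : ShuffleRDP.Prefix S i i.isLt.le),
      ShuffleRDP.IsLDP (ε₀ : ℝ) (fun x => R i x z)) :
    ShuffleRDP.IsRDP lam
      (max (ShuffleRDP.renyiDiv lam (ShuffleRDP.lawP n ε₀) (ShuffleRDP.lawQ n ε₀))
        (ShuffleRDP.renyiDiv lam (ShuffleRDP.lawQ n ε₀) (ShuffleRDP.lawP n ε₀)))
      (ShuffleRDP.shuffledProcess R) := by
  obtain ⟨m, rfl⟩ : ∃ m, n = m + 1 := ⟨n - 1, by omega⟩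
  intro X₀ X₁ hX
  obtain ⟨i₀, -, hi₀⟩ := hX
  obtain ⟨G, hGm, hG, h₀, h₁⟩ := ShuffleRDP.exists_clone_decomposition ε₀ R hR X₀ X₁ i₀
    fun j hj => by_contra fun h => hj (hi₀ j h)
  -- The first divergence suffices for either order of the data sets, since η₀ is always attached to
  -- the first one.
  refine le_trans ?_ (le_max_left _ _)
  rw [ShuffleRDP.shuffledProcess_eq_sum_wordLaw G R X₀ _ h₀,
    ShuffleRDP.shuffledProcess_eq_sum_wordLaw G R X₁ _ h₁,
    ShuffleRDP.sum_typeWeight_wordLaw G hG ε₀ i₀ _ _ _ (ShuffleRDP.lintegral_lawP ε₀ i₀),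
    ShuffleRDP.sum_typeWeight_wordLaw G hG ε₀ i₀ _ _ _ (ShuffleRDP.lintegral_lawQ ε₀ i₀)]
  exact ShuffleRDP.renyiDiv_mixture_le hlam _ _ _ _
    fun k _ => ShuffleRDP.countsLaw_univ_le_one G i₀ k
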